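/- Let $L$ be a unital Lie–Jordan Banach algebra: a real Banach space with a symmetric bilinear product $\circ$ with unit $\mathbf 1$ and an antisymmetric bilinear bracket $[\cdot,\cdot]$ which satisfy, for some nonzero $\hbar\in\mathbb R$ and all $a,b,c\in L$, the Jacobi identity, $[a,b\circ c]=[a,b]\circ c+b\circ[a,c]$ and $(a\circ b)\circ c-a\circ(b\circ c)=\hbar^2[b,[c,a]]$, and, with $a^2=a\circ a$, the norm conditions $\|a\circ b\|\le\|a\|\,\|b\|$, $\|[a,b]\|\le|\hbar|^{-1}\|a\|\,\|b\|$, $\|a^2\|=\|a\|^2$ and $\|a^2\|\le\|a^2+b^2\|$. A state of a unital Lie–Jordan algebra $A$ is a linear functional $\rho\colon A\to\mathbb R$ with $\rho(\mathbf 1)=1$ and $\rho(a^2)\ge 0$ for all $a\in A$. Let $\mathcal C\subseteq L$ be any subset (the constraints). The Dirac states are the states $\omega$ of $L$ with $\omega(c^2)=0$ for all $c\in\mathcal C$. Let $V=\{a\in L:\omega(a^2)=0\text{ for every Dirac state }\omega\}$ be the vanishing subalgebra and $N_V=\{a\in L:[a,V]\subseteq V\}$ its Lie normalizer. Then $V$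 is a Lie–Jordan ideal of the unital Lie–Jordan algebra $N_V$, so the reduced algebra $N_V/V$ is a unital Lie–Jordan algebra under the induced operations; let $\pi\colon N_V\to N_V/V$ be the quotient map. **Theorem.** The restrictions to $N_V$ of the Dirac states of $L$ are in one-to-one correspondence with the states of the reduced algebra $N_V/V$: the map $\tilde\omega\mapsto\tilde\omega\circ\pi$ is a bijection from the set of states of $N_V/V$ onto the set $\{\omega|_{N_V}:\omega\text{ a Dirac state of }L\}$. -/

import Mathlib

/-- A Lie-Jordan algebra: a real vector space with a symmetric bilinear Jordan product and an
antisymmetric bilinear Lie bracket satisfying the Jacobi identity, the Leibniz identity and the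
associator identity with respect to some real number `hbar`. -/
class LieJordanAlgebra (L : Type*) [AddCommGroup L] [Module ℝ L] where
  hbar : ℝ
  jordan : L →ₗ[ℝ] L →ₗ[ℝ] L
  lie : L →ₗ[ℝ] L →ₗ[ℝ] L
  jordan_comm : ∀ a b : L, jordan a b = jordan b a
  lie_antisymm : ∀ a b : L, lie a b = -lie b a
  jacobi : ∀ a b c : L, lie (lie a b) c + lie (lie c a) b + lie (lie b c) a = 0
  leibniz : ∀ a b c : L, lie a (jordan b c) = jordan (lie a b) c + jordan b (lie a c)
  associator : ∀ a b c : L,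
    jordan (jordan a b) c - jordan a (jordan b c) = hbar ^ 2 • lie b (lie c a)

/-- A Lie-Jordan algebra with a unit for the Jordan product. -/
class UnitalLieJordanAlgebra (L : Type*) [AddCommGroup L] [Module ℝ L]
    extends LieJordanAlgebra L where
  unit : L
  unit_jordan : ∀ a : L, jordan unit a = a

/-- The conditions on the norm of a Lie-Jordan algebra that make it a Lie-Jordan Banach algebra.
The bound on the Lie bracket involves the inverse of `hbar`, which is thus nonzero. -/
class IsLieJordanBanach (L : Type*) [NormedAddCommGroup L] [NormedSpace ℝ L]
    [LieJordanAlgebra L] : Prop where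
  complete : CompleteSpace L
  hbar_ne_zero : LieJordanAlgebra.hbar L ≠ 0
  norm_jordan_le : ∀ a b : L, ‖LieJordanAlgebra.jordan a b‖ ≤ ‖a‖ * ‖b‖
  norm_lie_le : ∀ a b : L,
    ‖LieJordanAlgebra.lie a b‖ ≤ |LieJordanAlgebra.hbar L|⁻¹ * (‖a‖ * ‖b‖)
  norm_sq : ∀ a : L, ‖LieJordanAlgebra.jordan a a‖ = ‖a‖ ^ 2
  norm_sq_le : ∀ a b : L, ‖LieJordanAlgebra.jordan a a‖ ≤
    ‖LieJordanAlgebra.jordan a a + LieJordanAlgebra.jordan b b‖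

namespace LieJordan

open LieJordanAlgebra UnitalLieJordanAlgebra

section General

variable {L : Type*} [AddCommGroup L] [Module ℝ L]

theorem lie_self [LieJordanAlgebra L] (a : L) : lie a a = 0 := by
  have h := lie_antisymm a a
  have h2 : (2 : ℝ) • lie a a = 0 := by
    rw [two_smul]
    nth_rewrite 1 [h]
    exact neg_add_cancel _
  exact (smul_eq_zero.mp h2).resolve_left two_ne_zero

theorem leibniz_left [LieJordanAlgebra L] (a b c : L) :
    lie (jordan a b) c = jordan (lie a c) b + jordan a (lie b c) := by
  rw [lie_antisymm, leibniz, lie_antisymm c a, lie_antisymm c b]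
  simp [add_comm]

theorem lie_unit [UnitalLieJordanAlgebra L] (a : L) : lie a (unit : L) = 0 := by
  have h := leibniz a (unit : L) unit
  rw [unit_jordan, jordan_comm, unit_jordan] at h
  exact left_eq_add.mp h

theorem unit_lie [UnitalLieJordanAlgebra L] (a : L) : lie (unit : L) a = 0 := by
  rw [lie_antisymm, lie_unit, neg_zero]

/-- A subspace containing the unit and closed under both products is a unital Lie-Jordan algebra
under the restricted operations. -/
abbrev subalgebraStructure [UnitalLieJordanAlgebra L] (N : Submodule ℝ L)
    (h1 : (unit : L) ∈ N) (hJ : ∀ a ∈ N, ∀ b ∈ N, jordan a b ∈ N)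
    (hL : ∀ a ∈ N, ∀ b ∈ N, lie a b ∈ N) : UnitalLieJordanAlgebra N where
  hbar := hbar L
  jordan := LinearMap.mk₂ ℝ (fun a b => ⟨jordan (a : L) b, hJ a a.2 b b.2⟩)
    (fun a b c => Subtype.ext (by simp)) (fun r a b => Subtype.ext (by simp))
    (fun a b c => Subtype.ext (by simp)) (fun r a b => Subtype.ext (by simp))
  lie := LinearMap.mk₂ ℝ (fun a b => ⟨lie (a : L) b, hL a a.2 b b.2⟩)
    (fun a b c => Subtype.ext (by simp)) (fun r a b => Subtype.ext (by simp))
    (fun a b c => Subtype.ext (by simp)) (fun r a b => Subtype.ext (by simp))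
  jordan_comm a b := Subtype.ext (jordan_comm (a : L) b)
  lie_antisymm a b := Subtype.ext (lie_antisymm (a : L) b)
  jacobi a b c := Subtype.ext (jacobi (a : L) b c)
  leibniz a b c := Subtype.ext (leibniz (a : L) b c)
  associator a b c := Subtype.ext (associator (a : L) b c)
  unit := ⟨unit, h1⟩
  unit_jordan a := Subtype.ext (unit_jordan (a : L))

/-- The bilinear operation induced on the quotient by a subspace that is absorbing on both
sides. -/
def quotientOp (I : Submodule ℝ L) (f : L →ₗ[ℝ] L →ₗ[ℝ] L)
    (hl : ∀ v ∈ I, ∀ a, f v a ∈ I) (hr : ∀ a, ∀ v ∈ I, f a v ∈ I) :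
    (L ⧸ I) →ₗ[ℝ] (L ⧸ I) →ₗ[ℝ] (L ⧸ I) :=
  I.liftQ
    (LinearMap.mk₂ ℝ (fun a x => I.mapQ I (f a) (fun v hv => hr a v hv) x)
      (fun a b x => by
        induction x using Submodule.Quotient.induction_on; simp [← Submodule.Quotient.mk_add])
      (fun r a x => by
        induction x using Submodule.Quotient.induction_on; simp [← Submodule.Quotient.mk_smul])
      (fun a x y => map_add _ x y) (fun r a x => map_smul _ r x))
    (fun v hv => LinearMap.ext fun x => by
      induction x using Submodule.Quotient.induction_on with
      | _ a => simpa using (Submodule.Quotient.mk_eq_zero I).mpr (hl v hv a))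

theorem quotientOp_mk (I : Submodule ℝ L) (f : L →ₗ[ℝ] L →ₗ[ℝ] L)
    (hl : ∀ v ∈ I, ∀ a, f v a ∈ I) (hr : ∀ a, ∀ v ∈ I, f a v ∈ I) (a b : L) :
    quotientOp I f hl hr (Submodule.Quotient.mk a) (Submodule.Quotient.mk b) =
      Submodule.Quotient.mk (f a b) := rfl

/-- The quotient of a unital Lie-Jordan algebra by a Lie-Jordan ideal, with the operations
`(a + I) ∘ (b + I) = a ∘ b + I`, `[a + I, b + I] = [a, b] + I` and the unit `1 + I`. -/
abbrev quotientStructure [UnitalLieJordanAlgebra L] (I : Submodule ℝ L)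
    (hJ : ∀ a, ∀ v ∈ I, jordan a v ∈ I) (hL : ∀ a, ∀ v ∈ I, lie a v ∈ I) :
    UnitalLieJordanAlgebra (L ⧸ I) where
  hbar := hbar L
  jordan := quotientOp I jordan (fun v hv a => by rw [jordan_comm]; exact hJ a v hv) hJ
  lie := quotientOp I lie (fun v hv a => by rw [lie_antisymm]; exact I.neg_mem (hL a v hv)) hL
  jordan_comm x y := by
    induction x using Submodule.Quotient.induction_on
    induction y using Submodule.Quotient.induction_on
    exact congrArg Submodule.Quotient.mk (jordan_comm _ _)
  lie_antisymm x y := by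
    induction x using Submodule.Quotient.induction_on
    induction y using Submodule.Quotient.induction_on
    exact congrArg Submodule.Quotient.mk (lie_antisymm _ _)
  jacobi x y z := by
    induction x using Submodule.Quotient.induction_on
    induction y using Submodule.Quotient.induction_on
    induction z using Submodule.Quotient.induction_on
    exact congrArg Submodule.Quotient.mk (jacobi _ _ _)
  leibniz x y z := by
    induction x using Submodule.Quotient.induction_on
    induction y using Submodule.Quotient.induction_on
    induction z using Submodule.Quotient.induction_on
    exact congrArg Submodule.Quotient.mk (leibniz _ _ _)
  associator x y z := by
    induction x using Submodule.Quotient.induction_on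
    induction y using Submodule.Quotient.induction_on
    induction z using Submodule.Quotient.induction_on
    exact congrArg Submodule.Quotient.mk (associator _ _ _)
  unit := Submodule.Quotient.mk unit
  unit_jordan x := by
    induction x using Submodule.Quotient.induction_on
    exact congrArg Submodule.Quotient.mk (unit_jordan _)

end General

section Reduction

variable {L : Type*} [AddCommGroup L] [Module ℝ L] [UnitalLieJordanAlgebra L]

variable (L) in
/-- The state space: real linear functionals that are normalized and nonnegative on squares. -/
def stateSpace : Set (L →ₗ[ℝ] ℝ) :=
  {ρ | ρ unit = 1 ∧ ∀ a : L, 0 ≤ ρ (jordan a a)}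

/-- The Dirac states with respect to the constraint set `C`: the states vanishing on the squares
of all constraints. -/
def diracStates (C : Set L) : Set (L →ₗ[ℝ] ℝ) :=
  {ω | ω ∈ stateSpace L ∧ ∀ c ∈ C, ω (jordan c c) = 0}

theorem state_jordan_eq_zero {ω : L →ₗ[ℝ] ℝ} (hω : ω ∈ stateSpace L) {v : L}
    (hv : ω (jordan v v) = 0) (b : L) : ω (jordan v b) = 0 := by
  by_contra hne
  have key : ∀ t : ℝ, 0 ≤ 2 * t * ω (jordan v b) + ω (jordan b b) := by
    intro t
    have h := hω.2 (t • v + b)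
    simp only [map_add, map_smul, LinearMap.add_apply, LinearMap.smul_apply, smul_eq_mul, hv,
      jordan_comm b v] at h
    linarith
  have h := key (-(ω (jordan b b) + 1) / (2 * ω (jordan v b)))
  field_simp at h
  linarith

theorem state_sq_jordan_eq_zero {ω : L →ₗ[ℝ] ℝ} (hω : ω ∈ stateSpace L) {v : L}
    (hv : ω (jordan v v) = 0) (b : L) : ω (jordan (jordan v v) b) = 0 := by
  refine state_jordan_eq_zero hω ?_ b
  have h := associator v v (jordan v v)
  rw [leibniz_left, lie_self] at h
  simp only [map_zero, LinearMap.zero_apply, add_zero, smul_zero, sub_eq_zero] at h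
  rw [h]
  exact state_jordan_eq_zero hω hv _

theorem state_lie_sq_eq_zero {ω : L →ₗ[ℝ] ℝ} (hω : ω ∈ stateSpace L) {v w : L}
    (hv : ω (jordan v v) = 0) (hw : ω (jordan w w) = 0) :
    (hbar L) ^ 2 * ω (jordan (lie v w) (lie v w)) = 0 := by
  have h := associator v v (jordan w w)
  have e : lie v (lie (jordan w w) v) =
      -((2 : ℝ) • (jordan (lie v w) (lie v w) + jordan w (lie v (lie v w)))) := by
    rw [leibniz_left, lie_antisymm w v, map_add, leibniz, leibniz]
    simp only [map_neg, LinearMap.neg_apply]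
    rw [jordan_comm (lie v (lie v w)) w, two_smul]
    abel
  rw [e] at h
  have h' := congrArg ω h
  simp only [map_sub, map_smul, map_neg, map_add, smul_eq_mul] at h'
  rw [state_sq_jordan_eq_zero hω hv, state_jordan_eq_zero hω hv, state_jordan_eq_zero hω hw] at h'
  linarith

theorem state_jordan_sq_eq_zero {ω : L →ₗ[ℝ] ℝ} (hω : ω ∈ stateSpace L) {v w : L}
    (hv : ω (jordan v v) = 0) (hw : ω (jordan w w) = 0) :
    ω (jordan (jordan v w) (jordan v w)) = 0 := by
  have h := associator v w (jordan v w)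
  have e : lie w (lie (jordan v w) v) =
      jordan (lie v w) (lie v w) - jordan v (lie w (lie v w)) := by
    rw [leibniz_left, lie_self, lie_antisymm w v]
    simp only [map_neg, map_zero, LinearMap.zero_apply, zero_add]
    rw [leibniz, lie_antisymm w v]
    simp only [map_neg, LinearMap.neg_apply]
    abel
  rw [e] at h
  have h' := congrArg ω h
  simp only [map_sub, map_smul, smul_eq_mul] at h'
  rw [state_jordan_eq_zero hω hv, state_jordan_eq_zero hω hv] at h'
  have := state_lie_sq_eq_zero hω hv hw
  linarith

/-- The vanishing subalgebra: the elements `a` with `ω (a²) = 0` for every Dirac state `ω`. -/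
def vanishingSubalgebra (C : Set L) : Submodule ℝ L where
  carrier := {a | ∀ ω ∈ diracStates C, ω (jordan a a) = 0}
  zero_mem' := fun ω _ => by simp
  add_mem' := fun {a b} ha hb ω hω => by
    have h := state_jordan_eq_zero hω.1 (ha ω hω) b
    simp [map_add, LinearMap.add_apply, ha ω hω, hb ω hω, h, jordan_comm b a]
  smul_mem' := fun r a ha ω hω => by simp [ha ω hω]

/-- The Lie normalizer of the vanishing subalgebra `V`: the elements `a` with `[a, V] ⊆ V`. -/
def lieNormalizer (C : Set L) : Submodule ℝ L where
  carrier := {a | ∀ v ∈ vanishingSubalgebra C, lie a v ∈ vanishingSubalgebra C}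
  zero_mem' := fun v _ => by simp
  add_mem' := fun {a b} ha hb v hv => by
    simpa using (vanishingSubalgebra C).add_mem (ha v hv) (hb v hv)
  smul_mem' := fun r a ha v hv => by
    simpa using (vanishingSubalgebra C).smul_mem r (ha v hv)

variable {C : Set L}

theorem jordan_mem_vanishing {v w : L} (hv : v ∈ vanishingSubalgebra C)
    (hw : w ∈ vanishingSubalgebra C) : jordan v w ∈ vanishingSubalgebra C :=
  fun ω hω => state_jordan_sq_eq_zero hω.1 (hv ω hω) (hw ω hω)

theorem lie_mem_vanishing (hh : hbar L ≠ 0) {v w : L} (hv : v ∈ vanishingSubalgebra C)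
    (hw : w ∈ vanishingSubalgebra C) : lie v w ∈ vanishingSubalgebra C :=
  fun ω hω => (mul_eq_zero.mp (state_lie_sq_eq_zero hω.1 (hv ω hω) (hw ω hω))).resolve_left
    (pow_ne_zero 2 hh)

theorem vanishing_le_normalizer (hh : hbar L ≠ 0) :
    vanishingSubalgebra C ≤ lieNormalizer C :=
  fun _ hv _ hw => lie_mem_vanishing hh hv hw

theorem apply_eq_zero_of_mem_vanishing {ω : L →ₗ[ℝ] ℝ} (hω : ω ∈ diracStates C) {v : L}
    (hv : v ∈ vanishingSubalgebra C) : ω v = 0 := by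
  have h := state_jordan_eq_zero hω.1 (hv ω hω) unit
  rwa [jordan_comm, unit_jordan] at h

theorem normalizer_jordan_mem_vanishing {a v : L} (ha : a ∈ lieNormalizer C)
    (hv : v ∈ vanishingSubalgebra C) : jordan a v ∈ vanishingSubalgebra C := by
  rw [jordan_comm]
  intro ω hω
  have h := associator v a (jordan v a)
  rw [leibniz_left v a v, lie_self] at h
  simp only [map_zero, LinearMap.zero_apply, zero_add] at h
  have h' := congrArg ω h
  simp only [map_sub, map_smul, smul_eq_mul] at h'
  rw [state_jordan_eq_zero hω.1 (hv ω hω), apply_eq_zero_of_mem_vanishing hω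
    (ha _ (jordan_mem_vanishing hv (ha v hv)))] at h'
  linarith

theorem unit_mem_normalizer : (unit : L) ∈ lieNormalizer C := fun v _ => by
  rw [unit_lie]
  exact Submodule.zero_mem _

theorem jordan_mem_normalizer {a b : L} (ha : a ∈ lieNormalizer C) (hb : b ∈ lieNormalizer C) :
    jordan a b ∈ lieNormalizer C := fun v hv => by
  rw [leibniz_left]
  refine Submodule.add_mem _ ?_ (normalizer_jordan_mem_vanishing ha (hb v hv))
  rw [jordan_comm]
  exact normalizer_jordan_mem_vanishing hb (ha v hv)

theorem lie_mem_normalizer {a b : L} (ha : a ∈ lieNormalizer C) (hb : b ∈ lieNormalizer C) :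
    lie a b ∈ lieNormalizer C := fun v hv => by
  have h := jacobi a b v
  have e : lie (lie a b) v = lie a (lie b v) - lie b (lie a v) := by
    rw [lie_antisymm (lie v a) b, lie_antisymm (lie b v) a, lie_antisymm v a, map_neg] at h
    rw [sub_eq_add_neg, ← sub_eq_zero, ← h]
    abel
  rw [e]
  exact Submodule.sub_mem _ (ha _ (hb v hv)) (hb _ (ha v hv))

variable (C) in
/-- The Lie normalizer is a unital Lie-Jordan algebra under the operations of `L`. -/
instance instNormalizer : UnitalLieJordanAlgebra (lieNormalizer C) :=
  subalgebraStructure _ unit_mem_normalizer (fun _ ha _ hb => jordan_mem_normalizer ha hb)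
    (fun _ ha _ hb => lie_mem_normalizer ha hb)

variable (C) in
/-- The reduced algebra: the quotient of the Lie normalizer by the vanishing subalgebra, which is
seen here as a subspace of the normalizer. When `L` is normed, so is the quotient, by the quotient
norm. -/
abbrev ReducedAlgebra : Type _ :=
  lieNormalizer C ⧸ (vanishingSubalgebra C).submoduleOf (lieNormalizer C)

variable (C) in
/-- The canonical unital Lie-Jordan algebra structure of the reduced algebra. -/
instance instReduced : UnitalLieJordanAlgebra (ReducedAlgebra C) :=
  quotientStructure _ (fun a _ hv => normalizer_jordan_mem_vanishing a.2 hv)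
    (fun a _ hv => a.2 _ hv)

variable (C) in
/-- The restrictions to the Lie normalizer of the Dirac states of `L`. -/
def restrictedDiracStates : Set (lieNormalizer C →ₗ[ℝ] ℝ) :=
  (fun ω : L →ₗ[ℝ] ℝ => ω.domRestrict (lieNormalizer C)) '' diracStates C

variable (C) in
/-- The quotient map from the Lie normalizer to the reduced algebra. -/
def quotientMap : lieNormalizer C →ₗ[ℝ] ReducedAlgebra C :=
  ((vanishingSubalgebra C).submoduleOf (lieNormalizer C)).mkQ

end Reduction

end LieJordan

/-!
A state `φ` of the reduced algebra pulls back to a state `φ ∘ π` of the normalizer `N_V`, and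
everything rests on extending the latter to a state of `L`. Any such extension is automatically a
Dirac state: a constraint `c` lies in `V`, hence so does `c²`, and `φ ∘ π` vanishes on `V`.

The extension is given by Hahn-Banach, as for C*-algebras, once positivity is translated into a
norm bound and back. Both translations use that `1 - a` is a square when `‖a‖ < 1`
(`exists_sq_eq_unit_sub`): writing the square root as `1 - y`, this is the equation
`y = (a + y²) / 2`, whose right-hand side is a contraction of the ball of radius `‖a‖`; as
`y² - z² = (y - z) ∘ (y + z)` in any commutative algebra, no power associativity is needed.

* A state satisfies `|ρ a| ≤ ‖a‖` (`abs_state_apply_le`). For `L` this shows that `V`, and hence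
  `N_V`, is closed, so that `N_V` is itself a Lie-Jordan Banach algebra and the bound holds for
  `φ ∘ π` too.
* A functional of norm at most one with value `1` at the unit is a state
  (`mem_stateSpace_of_norm_le_one`): if `‖a‖ < 1` then `1 - a² = b²`, and
  `‖b²‖ ≤ ‖b² + a²‖ = ‖1‖ ≤ 1` gives `ω (1 - a²) ≤ 1`.

Injectivity is surjectivity of `π`, and the restriction of a Dirac state descends to the quotient
because Dirac states vanish on `V`.
-/

namespace LieJordan

open LieJordanAlgebra UnitalLieJordanAlgebra

section Banach

variable {L : Type*} [NormedAddCommGroup L] [NormedSpace ℝ L] [UnitalLieJordanAlgebra L]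
  [IsLieJordanBanach L]

/-- The square root is `unit - y`, with `y` the fixed point of `y ↦ (a + y²) / 2` in the closed
ball of radius `‖a‖`, on which this map is Lipschitz with constant `‖a‖`. -/
theorem exists_sq_eq_unit_sub {a : L} (ha : ‖a‖ < 1) :
    ∃ b : L, jordan b b = unit - a := by
  have : CompleteSpace L := IsLieJordanBanach.complete
  set f : L → L := fun y => (2⁻¹ : ℝ) • (a + jordan y y) with hf
  have hmaps : Set.MapsTo f (Metric.closedBall 0 ‖a‖) (Metric.closedBall 0 ‖a‖) := by
    intro y hy
    rw [mem_closedBall_zero_iff] at hy ⊢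
    have h1 : ‖f y‖ ≤ 2⁻¹ * (‖a‖ + ‖jordan y y‖) := by
      rw [hf, norm_smul, Real.norm_of_nonneg (by norm_num)]
      gcongr
      exact norm_add_le _ _
    rw [IsLieJordanBanach.norm_sq] at h1
    nlinarith [norm_nonneg y, norm_nonneg a]
  have hlip : LipschitzWith ‖a‖₊ (hmaps.restrict f _ _) := by
    refine LipschitzWith.of_dist_le_mul fun y z => ?_
    have hy : ‖(y : L)‖ ≤ ‖a‖ := mem_closedBall_zero_iff.mp y.2
    have hz : ‖(z : L)‖ ≤ ‖a‖ := mem_closedBall_zero_iff.mp z.2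
    have e : f y - f z = (2⁻¹ : ℝ) • jordan ((y : L) - z) (y + z) := by
      simp only [hf, map_sub, map_add, LinearMap.sub_apply, jordan_comm (z : L) y, ← smul_sub]
      congr 1
      abel
    rw [Subtype.dist_eq, Subtype.dist_eq, dist_eq_norm, dist_eq_norm, coe_nnnorm]
    change ‖f y - f z‖ ≤ _
    rw [e, norm_smul, Real.norm_of_nonneg (by norm_num)]
    have h1 := IsLieJordanBanach.norm_jordan_le ((y : L) - z) (y + z)
    have h2 : ‖(y : L) + z‖ ≤ 2 * ‖a‖ := (norm_add_le _ _).trans (by linarith)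
    nlinarith [mul_le_mul_of_nonneg_left h2 (norm_nonneg ((y : L) - z))]
  obtain ⟨y, -, hy, -⟩ := ContractingWith.exists_fixedPoint'
    Metric.isClosed_closedBall.isComplete hmaps ⟨ha, hlip⟩
    (Metric.mem_closedBall_self (norm_nonneg a)) (edist_ne_top _ _)
  refine ⟨unit - y, ?_⟩
  have hy' : a + jordan y y = (2 : ℝ) • y := by
    conv_rhs => rw [← hy.eq]
    rw [hf, smul_smul]
    norm_num
  have e : jordan y y = (2 : ℝ) • y - a := eq_sub_of_add_eq' hy'
  simp only [map_sub, LinearMap.sub_apply, jordan_comm y unit, unit_jordan, e, two_smul]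
  abel

theorem norm_unit_le_one : ‖(unit : L)‖ ≤ 1 := by
  have h := IsLieJordanBanach.norm_sq (unit : L)
  rw [unit_jordan] at h
  nlinarith [norm_nonneg (unit : L)]

/-- For `r > ‖a‖` the element `unit - r⁻¹ • a` is a square, so that `ρ a ≤ r`. -/
theorem state_apply_le {ρ : L →ₗ[ℝ] ℝ} (hρ : ρ ∈ stateSpace L) (a : L) : ρ a ≤ ‖a‖ := by
  refine le_of_forall_gt_imp_ge_of_dense fun r hr => ?_
  have hr0 : 0 < r := (norm_nonneg a).trans_lt hr
  obtain ⟨b, hb⟩ := exists_sq_eq_unit_sub (a := r⁻¹ • a) (by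
    rwa [norm_smul, Real.norm_of_nonneg (inv_nonneg.mpr hr0.le), inv_mul_lt_one₀ hr0])
  have h := hρ.2 b
  rw [hb, map_sub, map_smul, hρ.1, smul_eq_mul, sub_nonneg] at h
  exact (inv_mul_le_one₀ hr0).mp h

theorem abs_state_apply_le {ρ : L →ₗ[ℝ] ℝ} (hρ : ρ ∈ stateSpace L) (a : L) : |ρ a| ≤ ‖a‖ :=
  abs_le'.mpr ⟨state_apply_le hρ a, by simpa using state_apply_le hρ (-a)⟩

theorem continuous_of_mem_stateSpace {ρ : L →ₗ[ℝ] ℝ} (hρ : ρ ∈ stateSpace L) : Continuous ρ :=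
  (ρ.mkContinuous 1 fun a => by simpa using abs_state_apply_le hρ a).continuous

theorem mem_stateSpace_of_norm_le_one {g : StrongDual ℝ L} (hg : ‖g‖ ≤ 1)
    (h1 : g unit = 1) : (g : L →ₗ[ℝ] ℝ) ∈ stateSpace L := by
  have small : ∀ a : L, ‖a‖ < 1 → 0 ≤ g (jordan a a) := by
    intro a ha
    obtain ⟨b, hb⟩ := exists_sq_eq_unit_sub (a := jordan a a) (by
      rw [IsLieJordanBanach.norm_sq]
      exact pow_lt_one₀ (norm_nonneg a) ha two_ne_zero)
    have hle : ‖jordan b b‖ ≤ 1 := by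
      refine (IsLieJordanBanach.norm_sq_le b a).trans ?_
      rw [hb, sub_add_cancel]
      exact norm_unit_le_one
    have h := (le_abs_self _).trans (g.le_of_opNorm_le_of_le hg hle)
    rw [hb, map_sub, h1] at h
    linarith
  refine ⟨h1, fun a => ?_⟩
  -- Rescaling into the open unit ball multiplies the square by a positive number.
  have hpos : 0 < ‖a‖ + 1 := by positivity
  have h := small ((‖a‖ + 1)⁻¹ • a) (by
    rw [norm_smul, Real.norm_of_nonneg (inv_nonneg.mpr hpos.le), inv_mul_lt_one₀ hpos]
    exact lt_add_one _)
  simp only [map_smul, LinearMap.smul_apply, smul_eq_mul, ← mul_assoc] at h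
  exact nonneg_of_mul_nonneg_right h (by positivity)

theorem continuous_jordan_self : Continuous fun a : L => jordan a a :=
  ((jordan (L := L)).mkContinuous₂ 1 fun a b => by
    simpa using IsLieJordanBanach.norm_jordan_le a b).continuous₂.comp
    (continuous_id.prodMk continuous_id)

theorem continuous_lie_left (b : L) : Continuous fun a : L => lie a b :=
  (((lie (L := L)).flip b).mkContinuous (|hbar L|⁻¹ * ‖b‖) fun a => by
    simpa [mul_assoc, mul_comm ‖b‖] using IsLieJordanBanach.norm_lie_le a b).continuous

variable (C : Set L)

theorem isClosed_vanishingSubalgebra : IsClosed (vanishingSubalgebra C : Set L) := by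
  change IsClosed {a : L | ∀ ω ∈ diracStates C, ω (jordan a a) = 0}
  simp only [Set.ofPred_forall]
  exact isClosed_iInter fun ω => isClosed_iInter fun hω => isClosed_eq
    ((continuous_of_mem_stateSpace hω.1).comp continuous_jordan_self) continuous_const

theorem isClosed_lieNormalizer : IsClosed (lieNormalizer C : Set L) := by
  change IsClosed {a : L | ∀ v ∈ vanishingSubalgebra C, lie a v ∈ vanishingSubalgebra C}
  simp only [Set.ofPred_forall]
  exact isClosed_iInter fun v => isClosed_iInter fun _ =>
    (isClosed_vanishingSubalgebra C).preimage (continuous_lie_left v)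

instance isLieJordanBanach_lieNormalizer : IsLieJordanBanach (lieNormalizer C) where
  complete :=
    have : CompleteSpace L := IsLieJordanBanach.complete
    (isClosed_lieNormalizer C).completeSpace_coe
  hbar_ne_zero := IsLieJordanBanach.hbar_ne_zero (L := L)
  norm_jordan_le a b := IsLieJordanBanach.norm_jordan_le (a : L) b
  norm_lie_le a b := IsLieJordanBanach.norm_lie_le (a : L) b
  norm_sq a := IsLieJordanBanach.norm_sq (a : L)
  norm_sq_le a b := IsLieJordanBanach.norm_sq_le (a : L) b

/-- The Hahn-Banach extension of a state of the normalizer has norm at most one, hence is a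
state. -/
theorem exists_state_extension {ρ : lieNormalizer C →ₗ[ℝ] ℝ}
    (hρ : ρ ∈ stateSpace (lieNormalizer C)) :
    ∃ ω ∈ stateSpace L, ω.domRestrict (lieNormalizer C) = ρ := by
  have hb : ∀ a, ‖ρ a‖ ≤ 1 * ‖a‖ := fun a => by simpa using abs_state_apply_le hρ a
  obtain ⟨g, hg, hn⟩ := exists_extension_norm_eq (lieNormalizer C) (ρ.mkContinuous 1 hb)
  refine ⟨g, mem_stateSpace_of_norm_le_one ?_ ?_, LinearMap.ext hg⟩
  · rw [hn]
    exact ρ.mkContinuous_norm_le zero_le_one hb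
  · exact (hg unit).trans hρ.1

end Banach

section Reduction

variable {L : Type*} [AddCommGroup L] [Module ℝ L] [UnitalLieJordanAlgebra L] {C : Set L}

theorem comp_quotientMap_mem_stateSpace {φ : ReducedAlgebra C →ₗ[ℝ] ℝ}
    (hφ : φ ∈ stateSpace (ReducedAlgebra C)) :
    φ ∘ₗ quotientMap C ∈ stateSpace (lieNormalizer C) :=
  ⟨hφ.1, fun a => hφ.2 (quotientMap C a)⟩

theorem quotientMap_eq_zero {a : lieNormalizer C} (ha : (a : L) ∈ vanishingSubalgebra C) :
    quotientMap C a = 0 :=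
  (Submodule.Quotient.mk_eq_zero _).mpr ha

theorem subset_vanishingSubalgebra : C ⊆ vanishingSubalgebra C :=
  fun c hc _ hω => hω.2 c hc

/-- A Dirac state vanishes on the vanishing subalgebra, so its restriction to the normalizer
factors through a state of the reduced algebra. -/
theorem exists_state_comp_quotientMap_eq {ω : L →ₗ[ℝ] ℝ} (hω : ω ∈ diracStates C) :
    ∃ φ ∈ stateSpace (ReducedAlgebra C),
      φ ∘ₗ quotientMap C = ω.domRestrict (lieNormalizer C) := by
  refine ⟨Submodule.liftQ _ (ω.domRestrict (lieNormalizer C))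
    fun v hv => apply_eq_zero_of_mem_vanishing hω hv,
    ⟨hω.1.1, fun x => ?_⟩, LinearMap.ext fun _ => rfl⟩
  induction x using Submodule.Quotient.induction_on with
  | _ a => exact hω.1.2 (a : L)

end Reduction

end LieJordan

/-- Composition with the quotient map is a bijection from the states of the reduced algebra onto
the restrictions to the Lie normalizer of the Dirac states. -/
theorem mainTheorem1 {L : Type*} [NormedAddCommGroup L] [NormedSpace ℝ L]
    [UnitalLieJordanAlgebra L] [IsLieJordanBanach L] (C : Set L) :
    Set.BijOn
      (fun φ : LieJordan.ReducedAlgebra C →ₗ[ℝ] ℝ => φ ∘ₗ LieJordan.quotientMap C)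
      (LieJordan.stateSpace (LieJordan.ReducedAlgebra C))
      (LieJordan.restrictedDiracStates C) := by
  refine ⟨fun φ hφ => ?_, fun φ _ ψ _ h => ?_, ?_⟩
  · obtain ⟨ω, hω, hext⟩ := LieJordan.exists_state_extension C
      (LieJordan.comp_quotientMap_mem_stateSpace hφ)
    refine ⟨ω, ⟨hω, fun c hc => ?_⟩, hext⟩
    -- The squares of the constraints lie in `V`, where `φ ∘ π` and thus its extension vanish.
    have hcc : LieJordanAlgebra.jordan c c ∈ LieJordan.vanishingSubalgebra C :=
      LieJordan.jordan_mem_vanishing (LieJordan.subset_vanishingSubalgebra hc)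
        (LieJordan.subset_vanishingSubalgebra hc)
    have hN := LieJordan.vanishing_le_normalizer (IsLieJordanBanach.hbar_ne_zero (L := L)) hcc
    have h := LinearMap.congr_fun hext ⟨_, hN⟩
    rw [LinearMap.comp_apply, LieJordan.quotientMap_eq_zero hcc, map_zero] at h
    exact h
  · exact (LinearMap.cancel_right (Submodule.mkQ_surjective _)).mp h
  · rintro _ ⟨ω, hω, rfl⟩
    exact LieJordan.exists_state_comp_quotientMap_eq hω
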